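/- Let $A,B\colon\mathbb R^n\to\mathbb R^n$ be linear operators and $f\colon[0,\infty)\times\mathbb R^n\to\mathbb R^n$ a continuous function that has a continuous partial derivative $\partial f/\partial x$ on $[0,\infty)\times\mathbb R^n$. Consider the Cauchy problem $$\frac{d}{dt}[Ax]+Bx=f(t,x),\qquad x(t_0)=x_0 .\tag{1}$$ A solution of (1) on $[t_0,t_1)$, $t_0<t_1\le\infty$, is a continuous function $x\colon[t_0,t_1)\to\mathbb R^n$ with $x(t_0)=x_0$ such that $Ax$ is continuously differentiable on $[t_0,t_1)$ and the equation holds on $[t_0,t_1)$. Assume that $\lambda A+B$ is a regular pencil of index 1, i.e. there are $C_1,C_2>0$ such that for all $\lambda\in\mathbb C$ with $|\lambda|\ge C_2$ the inverse $(\lambda A+B)^{-1}$ exists and $\|(\lambda A+B)^{-1}\|\le C_1$. Then there are unique decompositions $\mathbb R^n=X_1\dotplus X_2=Y_1\dotplus Y_2$ such that $A$ and $B$ map $X_j$ into $Y_j$ ($j=1,2$), $X_2=\operatorname{Ker}A$, $Y_1=A\mathbb R^n$, and $A\colon X_1\to Y_1$, $B\colon X_2\to Y_2$ are invertible (namely $X_1=B^{-1}(A\mathbb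 R^n)$ and $Y_2=B(\operatorname{Ker}A)$). Let $P_1,P_2$ be the projectors onto $X_1,X_2$ and $Q_1,Q_2$ the projectors onto $Y_1,Y_2$ given by these decompositions, let $G=A+BP_2$ (an invertible operator), and let $L_0=\{(t,x)\in[0,\infty)\times\mathbb R^n : Q_2[Bx-f(t,x)]=0\}$. Assume that for every $t\ge0$ and $x_{p_1}\in X_1$ there is $x_{p_2}\in X_2$ with $(t,x_{p_1}+x_{p_2})\in L_0$. Assume further that for all $t_*\ge 0$, $x_{p_1}^*\in X_1$ and $\hat x_{p_2},\hat{\hat x}_{p_2}\in X_2$ with $(t_*,x_{p_1}^*+\hat x_{p_2})\in L_0$ and $(t_*,x_{p_1}^*+\hat{\hat x}_{p_2})\in L_0$ the operator function $$\Phi\colon X_2\to L(X_2,Y_2),\qquad \Phi(x_{p_2})=\Big[\frac{\partial}{\partial x}\big(Q_2f(t_*,x_{p_1}^*+x_{p_2})\big)-B\Big]P_2$$ is basis invertible on the convex hull $\operatorname{conv}\{\hat x_{p_2},\hat{\hat x}_{p_2}\}$. This means that, with $s=\dim Y_2$, there are one-dimensional projectors $\Theta_1,\dots,\Theta_s$ in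 $Y_2$ with $\Theta_i\Theta_j=\delta_{ij}\Theta_i$ and $\sum_k\Theta_k=\mathrm{id}$ such that for any $w^1,\dots,w^s\in\operatorname{conv}\{\hat x_{p_2},\hat{\hat x}_{p_2}\}$ the operator $\sum_{k=1}^s\Theta_k\Phi(w^k)\colon X_2\to Y_2$ is invertible. Let $\Omega\subset X_1$ be a set (for example, a region) such that $0\notin\Omega$ and such that, for every solution $x$ of (1) on any interval $[t_0,t_1)$ with $(t_0,x_0)\in L_0$ and $P_1x_0\in\Omega$, one has $P_1x(t)\in\Omega$ for all $t\in[t_0,t_1)$. Suppose that there are a self-adjoint positive operator $H\in L(X_1)$ (that is, $(Hv,v)>0$ for $v\ne0$) and functions $k\in C([0,\infty),\mathbb R)$, $U\in C((0,\infty),(0,\infty))$ such that $$\int_c^{+\infty}\frac{dv}{U(v)}<+\infty\quad(c>0),\qquad \lim_{T\to+\infty}\int_{t_0}^{T}k(t)\,dt=+\infty\quad(t_0\ge 0),$$ $$\big(HP_1x,\;G^{-1}[-BP_1x+Q_1f(t,x)]\big)\ \ge\ k(t)\,U\big(\tfrac12(HP_1x,P_1x)\big)\qquad\text{for all }(t,x)\in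 L_0\text{ with }P_1x\in\Omega .$$ Then for each initial point $(t_0,x_0)\in L_0$ with $P_1x_0\in\Omega$ the Cauchy problem (1) has a unique solution, and this solution has a finite escape time (it is Lagrange unstable). That is, there are $T\in(t_0,\infty)$ and a solution $x$ of (1) on $[t_0,T)$ with $\lim_{t\to T-0}\|x(t)\|=+\infty$, and every solution $y$ of (1) on any interval $[t_0,t_1)$ satisfies $t_1\le T$ and $y=x$ on $[t_0,t_1)$. -/

import Mathlib

open Set Filter Topology

noncomputable section

namespace SemilinearDAE

/-- The space `ℝⁿ` with the standard inner product. -/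
abbrev Rn (n : ℕ) : Type := EuclideanSpace ℝ (Fin n)

/-! ### Regular pencils of index one -/

/-- The complex extension of a real operator on `ℝⁿ`: the operator on `ℂⁿ` with the same matrix. -/
def complexify {n : ℕ} (A : Rn n →L[ℝ] Rn n) :
    EuclideanSpace ℂ (Fin n) →L[ℂ] EuclideanSpace ℂ (Fin n) :=
  Matrix.toEuclideanCLM (n := Fin n) (𝕜 := ℂ)
    (((Matrix.toEuclideanCLM (n := Fin n) (𝕜 := ℝ)).symm A).map (algebraMap ℝ ℂ))

/-- The pencil `l A + B` at a complex number `l`. -/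
def pencil {n : ℕ} (A B : Rn n →L[ℝ] Rn n) (l : ℂ) :
    EuclideanSpace ℂ (Fin n) →L[ℂ] EuclideanSpace ℂ (Fin n) :=
  l • complexify A + complexify B

/-- `l A + B` is a regular pencil of index one: there are `C₁, C₂ > 0` such that for every complex
`l` with `|l| ≥ C₂` the inverse `R = (l A + B)⁻¹` exists and `‖R‖ ≤ C₁`. In particular
`det (l A + B)` does not vanish identically. -/
def IsIndexOnePencil {n : ℕ} (A B : Rn n →L[ℝ] Rn n) : Prop :=
  ∃ C₁ > (0 : ℝ), ∃ C₂ > (0 : ℝ), ∀ l : ℂ, C₂ ≤ ‖l‖ →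
    ∃ R : EuclideanSpace ℂ (Fin n) →L[ℂ] EuclideanSpace ℂ (Fin n),
      R * pencil A B l = 1 ∧ pencil A B l * R = 1 ∧ ‖R‖ ≤ C₁

/-! ### The subspaces and the projectors

The decompositions `ℝⁿ = X₁ ∔ X₂ = Y₁ ∔ Y₂` with `A, B : X_j → Y_j`, `X₂ = Ker A`, `Y₁ = A ℝⁿ`,
and `A : X₁ → Y₁`, `B : X₂ → Y₂` invertible, are unique: these requirements force `Y₂ = B (Ker A)`
and `X₁ = B⁻¹ (A ℝⁿ)`. -/

/-- `X₁ = {x | B x ∈ A ℝⁿ}`. -/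
def X₁ {n : ℕ} (A B : Rn n →L[ℝ] Rn n) : Submodule ℝ (Rn n) :=
  (LinearMap.range (A : Rn n →ₗ[ℝ] Rn n)).comap (B : Rn n →ₗ[ℝ] Rn n)

/-- `X₂ = Ker A`. -/
def X₂ {n : ℕ} (A : Rn n →L[ℝ] Rn n) : Submodule ℝ (Rn n) :=
  LinearMap.ker (A : Rn n →ₗ[ℝ] Rn n)

/-- `Y₁ = A ℝⁿ`. -/
def Y₁ {n : ℕ} (A : Rn n →L[ℝ] Rn n) : Submodule ℝ (Rn n) :=
  LinearMap.range (A : Rn n →ₗ[ℝ] Rn n)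

/-- `Y₂ = B (Ker A)`. -/
def Y₂ {n : ℕ} (A B : Rn n →L[ℝ] Rn n) : Submodule ℝ (Rn n) :=
  (LinearMap.ker (A : Rn n →ₗ[ℝ] Rn n)).map (B : Rn n →ₗ[ℝ] Rn n)

/-- The real form of the resolvent bound. -/
theorem IsIndexOnePencil.real_bound {n : ℕ} {A B : Rn n →L[ℝ] Rn n} (h : IsIndexOnePencil A B) :
    ∃ C₁ > (0 : ℝ), ∃ C₂ > (0 : ℝ), ∀ r : ℝ, C₂ ≤ r → ∀ x : Rn n,
      ‖x‖ ≤ C₁ * ‖r • A x + B x‖ := by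
  obtain ⟨C₁, h₁, C₂, h₂, h⟩ := h
  refine ⟨C₁, h₁, C₂, h₂, fun r hr x => ?_⟩
  obtain ⟨R, hR, -, hn⟩ := h (r : ℂ) (by
    rw [Complex.norm_real, Real.norm_eq_abs]
    exact hr.trans (le_abs_self r))
  let ι : Rn n → EuclideanSpace ℂ (Fin n) := fun y => WithLp.toLp 2 fun i => (y i : ℂ)
  have hι : ∀ y, ‖ι y‖ = ‖y‖ := fun y => by
    simp [ι, EuclideanSpace.norm_eq]
  have hc : ∀ (M : Rn n →L[ℝ] Rn n) (y : Rn n), complexify M (ι y) = ι (M y) := fun M y => by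
    have hM : Matrix.toEuclideanCLM (n := Fin n) (𝕜 := ℝ)
        ((Matrix.toEuclideanCLM (n := Fin n) (𝕜 := ℝ)).symm M) = M :=
      StarAlgEquiv.apply_symm_apply _ _
    unfold complexify
    generalize (Matrix.toEuclideanCLM (n := Fin n) (𝕜 := ℝ)).symm M = N at hM ⊢
    subst hM
    ext i
    simp [ι, Matrix.ofLp_toEuclideanCLM, Matrix.mulVec, dotProduct]
  have hp : pencil A B r (ι x) = ι (r • A x + B x) := by
    have : pencil A B r (ι x) = (r : ℂ) • complexify A (ι x) + complexify B (ι x) := rfl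
    rw [this, hc, hc]
    ext i
    simp [ι]
  have hx : R (pencil A B r (ι x)) = ι x := by
    have := congrArg (fun T => T (ι x)) hR
    simpa using this
  calc ‖x‖ = ‖R (ι (r • A x + B x))‖ := by rw [← hp, hx, hι]
    _ ≤ ‖R‖ * ‖ι (r • A x + B x)‖ := R.le_opNorm _
    _ ≤ C₁ * ‖r • A x + B x‖ := by rw [hι]; gcongr

theorem IsIndexOnePencil.eq_zero {n : ℕ} {A B : Rn n →L[ℝ] Rn n} (h : IsIndexOnePencil A B)
    {x y : Rn n} (hx : A x = 0) (hxy : B x = A y) : x = 0 := by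
  obtain ⟨C₁, h₁, C₂, h₂, h⟩ := h.real_bound
  have key : ∀ r : ℝ, C₂ ≤ r → ‖x - r⁻¹ • y‖ ≤ C₁ * ‖r⁻¹ • B y‖ := fun r hr => by
    have hr0 : r ≠ 0 := (h₂.trans_le hr).ne'
    have := h r hr (x - r⁻¹ • y)
    have e : r • A (x - r⁻¹ • y) + B (x - r⁻¹ • y) = -(r⁻¹ • B y) := by
      simp only [map_sub, map_smul, hx, hxy, smul_sub, smul_zero, smul_smul,
        mul_inv_cancel₀ hr0, one_smul]
      abel
    rwa [e, norm_neg] at this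
  have t₁ : Tendsto (fun r : ℝ => ‖x - r⁻¹ • y‖) atTop (𝓝 ‖x - (0 : ℝ) • y‖) :=
    (tendsto_const_nhds.sub (tendsto_inv_atTop_zero.smul_const y)).norm
  have t₂ : Tendsto (fun r : ℝ => C₁ * ‖r⁻¹ • B y‖) atTop (𝓝 (C₁ * ‖(0 : ℝ) • B y‖)) :=
    (tendsto_inv_atTop_zero.smul_const (B y)).norm.const_mul C₁
  have := le_of_tendsto_of_tendsto t₁ t₂ ((eventually_ge_atTop C₂).mono key)
  simpa using this

theorem IsIndexOnePencil.isCompl_Y {n : ℕ} {A B : Rn n →L[ℝ] Rn n} (h : IsIndexOnePencil A B) :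
    IsCompl (Y₁ A) (Y₂ A B) := by
  have hd : Disjoint (Y₁ A) (Y₂ A B) := by
    rw [Submodule.disjoint_def]
    rintro _ ⟨y, rfl⟩ ⟨x, hx, hxy⟩
    have hx0 : x = 0 := h.eq_zero (y := y) hx hxy
    rw [← hxy, hx0, map_zero]
  refine ⟨hd, codisjoint_iff.2 (Submodule.eq_top_of_disjoint _ _ ?_ hd)⟩
  have e : Module.finrank ℝ (Y₂ A B) = Module.finrank ℝ (LinearMap.ker (A : Rn n →ₗ[ℝ] Rn n)) := by
    have hi : Function.Injective
        ((B : Rn n →ₗ[ℝ] Rn n).domRestrict (LinearMap.ker (A : Rn n →ₗ[ℝ] Rn n))) := by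
      rw [← LinearMap.ker_eq_bot, LinearMap.ker_eq_bot']
      rintro ⟨x, hx⟩ hB
      have hB' : B x = 0 := hB
      exact Subtype.ext (h.eq_zero (y := 0) hx (by rw [hB', map_zero]))
    have hr := LinearMap.finrank_range_of_inj hi
    rwa [LinearMap.range_domRestrict] at hr
  rw [e]
  exact (LinearMap.finrank_range_add_finrank_ker (A : Rn n →ₗ[ℝ] Rn n)).ge

theorem IsIndexOnePencil.isCompl_X {n : ℕ} {A B : Rn n →L[ℝ] Rn n} (h : IsIndexOnePencil A B) :
    IsCompl (X₁ A B) (X₂ A) := by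
  constructor
  · rw [Submodule.disjoint_def]
    rintro x ⟨y, hy⟩ hx
    exact h.eq_zero hx hy.symm
  · rw [codisjoint_iff, eq_top_iff]
    intro x _
    have hB : B x ∈ Y₁ A ⊔ Y₂ A B := by
      rw [h.isCompl_Y.sup_eq_top]
      trivial
    obtain ⟨y, hy, _, ⟨k, hk, rfl⟩, hs⟩ := Submodule.mem_sup.1 hB
    refine Submodule.mem_sup.2 ⟨x - k, ?_, k, hk, sub_add_cancel x k⟩
    have : B (x - k) = y := by
      rw [map_sub, ← hs]
      exact add_sub_cancel_right _ _
    change B (x - k) ∈ Y₁ A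
    rwa [this]

section Projectors

variable {n : ℕ} {A B : Rn n →L[ℝ] Rn n}

/-- `P₁`, the projector onto `X₁` along `X₂`, as an operator from `ℝⁿ` to `X₁`. -/
def P₁ (h : IsIndexOnePencil A B) : Rn n →L[ℝ] X₁ A B :=
  ((X₁ A B).projectionOnto (X₂ A) h.isCompl_X).toContinuousLinearMap

/-- `P₂`, the projector onto `X₂` along `X₁`, as an operator from `ℝⁿ` to `X₂`. -/
def P₂ (h : IsIndexOnePencil A B) : Rn n →L[ℝ] X₂ A :=
  ((X₂ A).projectionOnto (X₁ A B) h.isCompl_X.symm).toContinuousLinearMap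

/-- `Q₁`, the projector onto `Y₁` along `Y₂`, as an operator from `ℝⁿ` to `Y₁`. -/
def Q₁ (h : IsIndexOnePencil A B) : Rn n →L[ℝ] Y₁ A :=
  ((Y₁ A).projectionOnto (Y₂ A B) h.isCompl_Y).toContinuousLinearMap

/-- `Q₂`, the projector onto `Y₂` along `Y₁`, as an operator from `ℝⁿ` to `Y₂`. -/
def Q₂ (h : IsIndexOnePencil A B) : Rn n →L[ℝ] Y₂ A B :=
  ((Y₂ A B).projectionOnto (Y₁ A) h.isCompl_Y.symm).toContinuousLinearMap

/-- The operator `G = A + B P₂`. -/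
def G (h : IsIndexOnePencil A B) : Rn n →L[ℝ] Rn n :=
  A + B ∘L (X₂ A).subtypeL ∘L P₂ h

theorem G_injective (h : IsIndexOnePencil A B) : Function.Injective (G h) := by
  rw [injective_iff_map_eq_zero]
  intro x hx
  have hx' : A x + B (P₂ h x : Rn n) = 0 := hx
  have h₂ : P₂ h x = 0 := by
    refine Subtype.ext (h.eq_zero (x := (P₂ h x : Rn n)) (y := -x) (P₂ h x).2 ?_)
    rw [map_neg]
    exact eq_neg_of_add_eq_zero_right hx'
  have hA : A x = 0 := by simpa [h₂] using hx'
  have := Submodule.projectionOnto_apply_left h.isCompl_X.symm (⟨x, hA⟩ : X₂ A)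
  have e : P₂ h x = ⟨x, hA⟩ := this
  rw [h₂] at e
  exact (congrArg Subtype.val e).symm

/-- The inverse operator `G⁻¹`. -/
def Ginv (h : IsIndexOnePencil A B) : Rn n →L[ℝ] Rn n :=
  ((LinearEquiv.ofInjectiveEndo (G h : Rn n →ₗ[ℝ] Rn n) (G_injective h)).symm :
    Rn n →ₗ[ℝ] Rn n).toContinuousLinearMap

end Projectors

/-! ### Basis invertibility -/

/-- An additive resolution of the identity in the `s`-dimensional space `Z`: one-dimensional
projectors `Θ₁, …, Θ_s` with `Θ_i Θ_j = δ_ij Θ_i` and `∑ Θ_k = id`. -/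
structure IsAdditiveResolution {Z : Type*} [NormedAddCommGroup Z] [NormedSpace ℝ Z]
    (Θ : Fin (Module.finrank ℝ Z) → Z →L[ℝ] Z) : Prop where
  rank_one : ∀ k, Module.finrank ℝ (LinearMap.range (Θ k : Z →ₗ[ℝ] Z)) = 1
  mul_eq : ∀ i j, Θ i * Θ j = if i = j then Θ i else 0
  sum_eq : ∑ k, Θ k = 1

/-- An operator function `Φ` with values in `L(W, Z)` is basis invertible on `S`: for some additive
resolution of the identity `Θ` in `Z`, all operators `Λ = ∑ Θ_k Φ(w^k)` with `w^k ∈ S` have an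
inverse. -/
def IsBasisInvertibleOn {W Z : Type*} [NormedAddCommGroup W] [NormedSpace ℝ W]
    [NormedAddCommGroup Z] [NormedSpace ℝ Z] (Φ : W → W →L[ℝ] Z) (S : Set W) : Prop :=
  ∃ Θ : Fin (Module.finrank ℝ Z) → Z →L[ℝ] Z, IsAdditiveResolution Θ ∧
    ∀ w : Fin (Module.finrank ℝ Z) → W, (∀ k, w k ∈ S) →
      (∑ k, Θ k ∘L Φ (w k)).IsInvertible

/-! ### The semilinear DAE `d/dt [A x] + B x = f(t, x)` -/

section DAE

variable {n : ℕ} {A B : Rn n →L[ℝ] Rn n}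

/-- The consistency manifold `L₀ = {(t, x) | t ≥ 0, Q₂ [B x - f(t, x)] = 0}`. -/
def L₀ (h : IsIndexOnePencil A B) (f : ℝ → Rn n → Rn n) : Set (ℝ × Rn n) :=
  {p | 0 ≤ p.1 ∧ Q₂ h (B p.2 - f p.1 p.2) = 0}

/-- `B` as an operator from `X₂ = Ker A` to `Y₂ = B (Ker A)`. -/
def B₂ (A B : Rn n →L[ℝ] Rn n) : X₂ A →L[ℝ] Y₂ A B :=
  (B ∘L (X₂ A).subtypeL).codRestrict (Y₂ A B) fun x => Submodule.mem_map_of_mem x.2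

/-- The operator function `Φ(u) = [∂/∂x (Q₂ f(t, v + u)) - B] P₂` from `X₂` to `L(X₂, Y₂)`
(for fixed `t` and `v`). On `X₂` the projector `P₂` is the identity. -/
def Φ (h : IsIndexOnePencil A B) (f : ℝ → Rn n → Rn n) (t : ℝ) (v : X₁ A B) (u : X₂ A) :
    X₂ A →L[ℝ] Y₂ A B :=
  fderiv ℝ (fun x => Q₂ h (f t x)) ((v : Rn n) + (u : Rn n)) ∘L (X₂ A).subtypeL - B₂ A B

/-- The interval `[t₀, t₁)`, where `t₁ ≤ ∞`. -/
def interval (t₀ : ℝ) (t₁ : EReal) : Set ℝ := {t | t₀ ≤ t ∧ (t : EReal) < t₁}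

/-- `x` is a solution on `[t₀, t₁)` of the Cauchy problem `d/dt [A x] + B x = f(t, x)`,
`x(t₀) = x₀`. At `t₀` the derivative is one-sided. -/
structure IsSolution (A B : Rn n →L[ℝ] Rn n) (f : ℝ → Rn n → Rn n) (t₀ : ℝ) (x₀ : Rn n)
    (t₁ : EReal) (x : ℝ → Rn n) : Prop where
  lt : (t₀ : EReal) < t₁
  continuousOn : ContinuousOn x (interval t₀ t₁)
  contDiffOn : ContDiffOn ℝ 1 (fun t => A (x t)) (interval t₀ t₁)
  eqn : ∀ t ∈ interval t₀ t₁,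
    derivWithin (fun s => A (x s)) (interval t₀ t₁) t + B (x t) = f t (x t)
  initial : x t₀ = x₀

end DAE

end SemilinearDAE

end

/-!
On the consistency manifold `L₀` the differential-algebraic equation is an ordinary differential
equation for the component `z = P₁ x` in `X₁`. Indeed `A x = A z`, so that applying `G⁻¹ Q₁` to
the equation gives `z' = G⁻¹ [-B z + Q₁ f(t, x)]`, while applying `Q₂` gives the algebraic
condition `Q₂ [f(t, x) - B x] = 0`, which determines `x` from `t` and `z`.

* Uniqueness of this `x` is global. Along the segment between two candidates with the same `P₁`
  component, the mean value theorem applied to each component `Θ_k` yields points `w^k` for which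
  `∑ Θ_k Φ(w^k)` annihilates the difference of the candidates
  (`IsBasisInvertibleOn.eq_of_apply_eq`).
* Since `Φ` itself is invertible at a consistent point, the map `x ↦ (P₁ x, Q₂ [f(t, x) - B x])`
  has an invertible derivative there. As it is only continuous in `t`, an inverse function theorem
  with a parameter (`exists_antilipschitz_and_eventually_exists_eq`) takes the place of the implicit
  function theorem. It shows that `x` is continuous in `(t, z)` and locally Lipschitz in `z`; the
  local solutions that it provides coincide with `x` because of the global uniqueness.
* Hence the reduced equation has a locally Lipschitz right-hand side, and its solutions correspond
  to those of the original problem (`IsSolution.isIntegralCurveOn`,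
  `isSolution_of_isIntegralCurveOn`).

Along a solution `W = (H z, z) / 2` is positive, because `z` stays in `Ω` and `0 ∉ Ω`, and
`W' = (H z, z') ≥ k U(W)`. Therefore `∫ k` over the interval of existence is at most the finite
number `∫ 1 / U` over `(W(t₀), ∞)` (`integral_le_integral_Ioi_of_mul_le_deriv`), and since `∫ k`
diverges, the times of existence are bounded. The maximal solution then leaves every bounded set at
the end of its interval (`exists_maximal_isIntegralCurveOn`). Because `k` may change sign, `W` need
not grow monotonically, so that blow-up is a consequence of maximality and not of an estimate from
below.
-/

namespace SemilinearDAE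

open scoped NNReal

/-! ### Families of maps that are locally Lipschitz uniformly in a parameter -/

section Parameter

variable {T E F F' : Type*} [TopologicalSpace T]
  [NormedAddCommGroup E] [NormedAddCommGroup F] [NormedAddCommGroup F']

/-- Every point `(t₀, x₀)` has a neighbourhood on which the maps `N t` are Lipschitz in `x`, with
a constant that does not depend on `t`. -/
def LocallyLipschitzUniformly (N : T → E → F) : Prop :=
  ∀ (t₀ : T) (x₀ : E), ∃ K : ℝ≥0, ∃ V ∈ 𝓝 x₀, ∀ᶠ t in 𝓝 t₀, LipschitzOnWith K (N t) V

theorem LocallyLipschitzUniformly.comp {N : T → F → F'} {σ : T → E → F}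
    (hN : LocallyLipschitzUniformly N) (hσ : LocallyLipschitzUniformly σ)
    (hc : Continuous fun p : T × E => σ p.1 p.2) :
    LocallyLipschitzUniformly fun t x => N t (σ t x) := by
  intro t₀ x₀
  obtain ⟨K, V, hV, hK⟩ := hN t₀ (σ t₀ x₀)
  obtain ⟨K', V', hV', hK'⟩ := hσ t₀ x₀
  have hev : ∀ᶠ p : T × E in 𝓝 t₀ ×ˢ 𝓝 x₀, σ p.1 p.2 ∈ V := by
    rw [← nhds_prod_eq]
    exact hc.continuousAt.eventually hV
  obtain ⟨p, hp, q, hq, hpq⟩ := eventually_prod_iff.1 hev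
  refine ⟨K * K', V' ∩ {x | q x}, inter_mem hV' hq, ?_⟩
  filter_upwards [hK, hK', hp] with t h₁ h₂ h₃
  exact h₁.comp (h₂.mono inter_subset_left) fun x hx => hpq h₃ hx.2

theorem LocallyLipschitzUniformly.add {N N' : T → E → F}
    (hN : LocallyLipschitzUniformly N) (hN' : LocallyLipschitzUniformly N') :
    LocallyLipschitzUniformly fun t x => N t x + N' t x := by
  intro t₀ x₀
  obtain ⟨K, V, hV, hK⟩ := hN t₀ x₀
  obtain ⟨K', V', hV', hK'⟩ := hN' t₀ x₀
  refine ⟨K + K', V ∩ V', inter_mem hV hV', ?_⟩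
  filter_upwards [hK, hK'] with t h₁ h₂
  exact (h₁.mono inter_subset_left).add (h₂.mono inter_subset_right)

theorem LocallyLipschitzUniformly.of_lipschitzWith {K : ℝ≥0} {N : T → E → F}
    (h : ∀ t, LipschitzWith K (N t)) : LocallyLipschitzUniformly N := fun _ _ =>
  ⟨K, univ, univ_mem, Eventually.of_forall fun t => (h t).lipschitzOnWith⟩

variable [NormedSpace ℝ E] [NormedSpace ℝ F]

theorem LocallyLipschitzUniformly.of_continuous_fderiv {N : T → E → F}
    (hd : ∀ t, Differentiable ℝ (N t))
    (hc : Continuous fun p : T × E => fderiv ℝ (N p.1) p.2) : LocallyLipschitzUniformly N := by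
  intro t₀ x₀
  have hev : ∀ᶠ p : T × E in 𝓝 t₀ ×ˢ 𝓝 x₀,
      ‖fderiv ℝ (N p.1) p.2‖₊ < ‖fderiv ℝ (N t₀) x₀‖₊ + 1 := by
    rw [← nhds_prod_eq]
    exact hc.nnnorm.continuousAt.eventually (gt_mem_nhds (by simp))
  obtain ⟨p, hp, q, hq, hpq⟩ := eventually_prod_iff.1 hev
  obtain ⟨ε, hε, hqε⟩ := Metric.eventually_nhds_iff_ball.1 hq
  refine ⟨‖fderiv ℝ (N t₀) x₀‖₊ + 1, Metric.ball x₀ ε, Metric.ball_mem_nhds _ hε, ?_⟩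
  filter_upwards [hp] with t ht
  exact (convex_ball x₀ ε).lipschitzOnWith_of_nnnorm_fderiv_le (fun x _ => hd t x)
    fun x hx => (hpq ht (hqε x hx)).le

/-- The inverse function theorem with a parameter `t` on which the maps `N t` depend only
continuously: near `x₀` the inverses of the `N t` are Lipschitz with a common constant, and the
equation `N t x = y` with `(t, y)` near `(t₀, N t₀ x₀)` has solutions `x` as close to `x₀` as
desired. -/
theorem exists_antilipschitz_and_eventually_exists_eq [CompleteSpace E] {N : T → E → F} {t₀ : T}
    {x₀ : E} (hd : ∀ t, Differentiable ℝ (N t)) (hN : ContinuousAt (fun t => N t x₀) t₀)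
    (hc : ContinuousAt (fun p : T × E => fderiv ℝ (N p.1) p.2) (t₀, x₀)) (L : E ≃L[ℝ] F)
    (hL : (L : E →L[ℝ] F) = fderiv ℝ (N t₀) x₀) :
    (∃ K : ℝ≥0, ∃ V ∈ 𝓝 x₀, ∀ᶠ t in 𝓝 t₀, ∀ x ∈ V, ∀ y ∈ V, dist x y ≤ K * dist (N t x) (N t y)) ∧
      ∀ V ∈ 𝓝 x₀, ∀ᶠ p in 𝓝 (t₀, N t₀ x₀), ∃ x ∈ V, N p.1 x = p.2 := by
  set M : ℝ≥0 := ‖(L.symm : F →L[ℝ] E)‖₊ + 1 with hM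
  have hM₀ : 0 < M := by positivity
  set c : ℝ≥0 := (2 * M)⁻¹ with hc'
  have hMc : (M : ℝ) * c = 1 / 2 := by
    have : (M : ℝ) ≠ 0 := by exact_mod_cast hM₀.ne'
    rw [hc']; push_cast; field_simp
  have hc₀ : 0 < (c : ℝ) := by rw [hc']; positivity
  have hM₁ : ∀ y, ‖L.symm y‖ ≤ M * ‖y‖ := fun y =>
    ((L.symm : F →L[ℝ] E).le_opNorm y).trans (by rw [hM]; gcongr; simp)
  have hev : ∀ᶠ p : T × E in 𝓝 t₀ ×ˢ 𝓝 x₀, ‖fderiv ℝ (N p.1) p.2 - (L : E →L[ℝ] F)‖ < c := by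
    rw [← nhds_prod_eq, hL]
    refine (hc.sub continuousAt_const).norm.eventually (gt_mem_nhds ?_)
    simpa using hc₀
  obtain ⟨p, hp, q, hq, hpq⟩ := eventually_prod_iff.1 hev
  obtain ⟨ε, hε, hqε⟩ := Metric.eventually_nhds_iff_ball.1 hq
  have happ : ∀ t, p t → ApproximatesLinearOn (N t) (L : E →L[ℝ] F) (Metric.ball x₀ ε) c :=
    fun t ht x hx y hy => (convex_ball x₀ ε).norm_image_sub_le_of_norm_fderiv_le'
      (fun z _ => hd t z) (fun z hz => (hpq ht (hqε z hz)).le) hy hx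
  constructor
  · refine ⟨2 * M, Metric.ball x₀ ε, Metric.ball_mem_nhds _ hε, ?_⟩
    filter_upwards [hp] with t ht x hx y hy
    have h₁ := happ t ht x hx y hy
    have h₂ : ‖x - y‖ ≤ M * ‖L (x - y)‖ := by simpa using hM₁ (L (x - y))
    have h₃ : ‖L (x - y)‖ ≤ ‖N t x - N t y‖ + c * ‖x - y‖ := by
      have := norm_sub_le (N t x - N t y) (N t x - N t y - L (x - y))
      rw [sub_sub_cancel] at this
      exact this.trans (by gcongr; exact h₁)
    have h₄ : ‖x - y‖ ≤ M * (‖N t x - N t y‖ + c * ‖x - y‖) := h₂.trans (by gcongr)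
    rw [dist_eq_norm, dist_eq_norm]
    have h₅ : (M : ℝ) * (‖N t x - N t y‖ + c * ‖x - y‖)
        = M * ‖N t x - N t y‖ + (M * c) * ‖x - y‖ := by ring
    rw [h₅, hMc] at h₄
    push_cast
    linarith
  · intro V hV
    obtain ⟨δ, hδ, hδV⟩ := Metric.nhds_basis_closedBall.mem_iff.1
      (inter_mem hV (Metric.ball_mem_nhds x₀ hε))
    let R : (L : E →L[ℝ] F).NonlinearRightInverse :=
      ⟨L.symm, M, hM₁, fun y => L.apply_symm_apply y⟩
    have hr : 0 < ((M : ℝ)⁻¹ - c) * δ := by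
      have : (M : ℝ)⁻¹ = 2 * c := by
        rw [hc']; push_cast; field_simp
      rw [this]
      have : 0 < (2 * (c : ℝ) - c) := by linarith
      positivity
    have h₁ : ∀ᶠ z : T × F in 𝓝 (t₀, N t₀ x₀), dist z.2 (N z.1 x₀) < ((M : ℝ)⁻¹ - c) * δ := by
      have h₂ : ContinuousAt (fun z : T × F => dist z.2 (N z.1 x₀)) (t₀, N t₀ x₀) :=
        continuousAt_snd.dist (ContinuousAt.comp (f := Prod.fst) (g := fun t => N t x₀) hN
          continuousAt_fst)
      exact h₂.eventually (gt_mem_nhds (by simpa using hr))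
    filter_upwards [h₁, (continuousAt_fst (p := (t₀, N t₀ x₀))).eventually hp] with z hz hpz
    obtain ⟨x, hx, hxz⟩ := (happ z.1 hpz).surjOn_closedBall_of_nonlinearRightInverse R hδ.le
      (fun y hy => (hδV hy).2) (Metric.mem_closedBall.2 hz.le)
    exact ⟨x, (hδV hx).1, hxz⟩

end Parameter

/-! ### Maximal solutions of ordinary differential equations -/

section ODE

variable {E : Type*} [NormedAddCommGroup E] [NormedSpace ℝ E] {g : ℝ → E → E}

theorem hasDerivWithinAt_Ici_of_Icc {α : ℝ → E} {v : E} {a b t : ℝ}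
    (h : HasDerivWithinAt α v (Icc a b) t) (ht : t ∈ Ico a b) : HasDerivWithinAt α v (Ici t) t :=
  h.mono_of_mem_nhdsWithin (mem_of_superset (Icc_mem_nhdsGE ht.2) (Icc_subset_Icc_left ht.1))

theorem eqOn_Icc_of_isIntegralCurveOn (hg : LocallyLipschitzUniformly g) {α β : ℝ → E} {a b : ℝ}
    (hα : IsIntegralCurveOn α g (Icc a b)) (hβ : IsIntegralCurveOn β g (Icc a b))
    (hab : α a = β a) : EqOn α β (Icc a b) := by
  change Icc a b ⊆ {t | α t = β t}
  rcases lt_or_ge b a with h | h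
  · simp [Icc_eq_empty_of_lt h]
  have hcl : IsClosed ({t | α t = β t} ∩ Icc a b) := by
    rw [inter_comm]
    exact isClosed_Icc.isClosed_eq hα.continuousOn hβ.continuousOn
  refine hcl.Icc_subset_of_forall_mem_nhdsWithin hab fun t ⟨ht, htab⟩ => ?_
  obtain ⟨K, V, hV, hK⟩ := hg t (α t)
  have hIcc : Icc a b ∈ 𝓝[≥] t :=
    mem_of_superset (Icc_mem_nhdsGE htab.2) (Icc_subset_Icc_left htab.1)
  have hα' : ∀ᶠ s in 𝓝[≥] t, α s ∈ V :=
    ((hα.continuousOn t (Ico_subset_Icc_self htab)).mono_of_mem_nhdsWithin hIcc).eventually hV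
  have hβ' : ∀ᶠ s in 𝓝[≥] t, β s ∈ V :=
    ((hβ.continuousOn t (Ico_subset_Icc_self htab)).mono_of_mem_nhdsWithin hIcc).eventually
      (by rwa [← show α t = β t from ht])
  obtain ⟨u, hu, hus⟩ := (mem_nhdsGE_iff_exists_Icc_subset).1
    (inter_mem hIcc (inter_mem (inter_mem hα' hβ') (mem_nhdsWithin_of_mem_nhds hK)))
  have hs : ∀ s ∈ Icc t u, s ∈ Icc a b := fun s hs => (hus hs).1
  have hsub : Icc t u ⊆ Icc a b := hs
  have := ODE_solution_unique_of_mem_Icc_right (v := g) (s := fun _ => V) (K := K) (a := t) (b := u)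
    (fun s hs => (hus (Ico_subset_Icc_self hs)).2.2)
    (hα.continuousOn.mono hsub)
    (fun s hs => hasDerivWithinAt_Ici_of_Icc (hα.mono hsub s (Ico_subset_Icc_self hs)) hs)
    (fun s hs => (hus (Ico_subset_Icc_self hs)).2.1.1)
    (hβ.continuousOn.mono hsub)
    (fun s hs => hasDerivWithinAt_Ici_of_Icc (hβ.mono hsub s (Ico_subset_Icc_self hs)) hs)
    (fun s hs => (hus (Ico_subset_Icc_self hs)).2.1.2) ht
  exact mem_of_superset (Icc_mem_nhdsGT hu) this

/-- Two integral curves on adjacent intervals with a common value at the common endpoint form one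
integral curve. -/
theorem isIntegralCurveOn_ite_le {α β : ℝ → E} {a s b : ℝ} (has : a ≤ s) (hsb : s ≤ b)
    (hα : IsIntegralCurveOn α g (Icc a s)) (hβ : IsIntegralCurveOn β g (Icc s b))
    (h : α s = β s) : IsIntegralCurveOn (fun t => if t ≤ s then α t else β t) g (Icc a b) := by
  intro t ht
  have e₁ : EqOn (fun t => if t ≤ s then α t else β t) α (Icc a s) := fun r hr => if_pos hr.2
  have e₂ : EqOn (fun t => if t ≤ s then α t else β t) β (Icc s b) := fun r hr => by
    rcases hr.1.eq_or_lt with rfl | hr'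
    · simpa using h
    · exact if_neg hr'.not_ge
  rw [← Icc_union_Icc_eq_Icc has hsb]
  refine HasDerivWithinAt.union ?_ ?_
  · by_cases hts : t ∈ Icc a s
    · have := (hα t hts).congr e₁ (e₁ hts)
      rwa [← e₁ hts] at this
    · exact HasFDerivWithinAt.of_notMem_closure (by rwa [isClosed_Icc.closure_eq])
  · by_cases hts : t ∈ Icc s b
    · have := (hβ t hts).congr e₂ (e₂ hts)
      rwa [← e₂ hts] at this
    · exact HasFDerivWithinAt.of_notMem_closure (by rwa [isClosed_Icc.closure_eq])

/-- Local solvability with a time of existence that is uniform in the initial time and the initial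
value. -/
theorem exists_isIntegralCurveOn_Icc [CompleteSpace E] (hg : LocallyLipschitzUniformly g)
    (hc : Continuous fun p : ℝ × E => g p.1 p.2) (t₀ : ℝ) (x₀ : E) :
    ∃ ε > 0, ∀ s ∈ Icc (t₀ - ε) (t₀ + ε), ∀ x ∈ Metric.closedBall x₀ ε, ∃ α : ℝ → E, α s = x ∧
      IsIntegralCurveOn α g (Icc (t₀ - ε) (t₀ + ε)) := by
  obtain ⟨K, V, hV, hK⟩ := hg t₀ x₀
  have hev : ∀ᶠ p : ℝ × E in 𝓝 t₀ ×ˢ 𝓝 x₀, ‖g p.1 p.2‖₊ < ‖g t₀ x₀‖₊ + 1 := by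
    rw [← nhds_prod_eq]
    exact hc.nnnorm.continuousAt.eventually (gt_mem_nhds (by simp))
  obtain ⟨p, hp, q, hq, hpq⟩ := eventually_prod_iff.1 hev
  obtain ⟨a, ha, haV⟩ := Metric.nhds_basis_closedBall.mem_iff.1 (inter_mem hV hq)
  obtain ⟨δ, hδ, hδp⟩ := Metric.nhds_basis_closedBall.mem_iff.1 (inter_mem hK hp)
  set L : ℝ≥0 := ‖g t₀ x₀‖₊ + 1 with hL
  -- `ε` is so small that curves of speed at most `L` that start within distance `ε` of `x₀` stay
  -- within distance `a` of it for the time `2 * ε`.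
  set ε : ℝ := min δ (a / (2 * L + 1)) with hε
  have hε₀ : 0 < ε := lt_min hδ (by positivity)
  have hεa : (2 * L + 1) * ε ≤ a := by
    have : ε ≤ a / (2 * L + 1) := min_le_right _ _
    rwa [le_div_iff₀ (by positivity), mul_comm] at this
  have hsub : ∀ t ∈ Icc (t₀ - ε) (t₀ + ε), t ∈ Metric.closedBall t₀ δ := fun t ht => by
    have : ε ≤ δ := min_le_left _ _
    rw [Real.closedBall_eq_Icc]
    exact ⟨by linarith [ht.1], by linarith [ht.2]⟩
  refine ⟨ε, hε₀, fun s hs x hx => ?_⟩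
  have hPL : IsPicardLindelof g (tmin := t₀ - ε) (tmax := t₀ + ε) ⟨s, hs⟩ x₀ ⟨a, ha.le⟩
      ⟨ε, hε₀.le⟩ L K := by
    refine ⟨fun t ht => (hδp (hsub t ht)).1.mono fun y hy => (haV hy).1,
      fun y _ => (hc.comp (by fun_prop : Continuous fun t : ℝ => (t, y))).continuousOn,
      fun t ht y hy => ?_, ?_⟩
    · exact (hpq (hδp (hsub t ht)).2 (haV hy).2).le
    · have h₁ : max (t₀ + ε - s) (s - (t₀ - ε)) ≤ 2 * ε :=
        max_le (by linarith [hs.1]) (by linarith [hs.2])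
      have h₂ : (L : ℝ) * max (t₀ + ε - s) (s - (t₀ - ε)) ≤ L * (2 * ε) := by gcongr
      change (L : ℝ) * max (t₀ + ε - s) (s - (t₀ - ε)) ≤ a - ε
      linarith
  exact hPL.exists_eq_forall_mem_Icc_hasDerivWithinAt hx

/-- If the times of existence of the solutions with initial value `x₀` at time `t₀` are bounded,
then there is a maximal solution, and it leaves every bounded set as `t` tends to the right end
`T` of its interval. -/
theorem exists_maximal_isIntegralCurveOn [ProperSpace E] (hg : LocallyLipschitzUniformly g)
    (hc : Continuous fun p : ℝ × E => g p.1 p.2) (t₀ : ℝ) (x₀ : E) (M : ℝ)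
    (hM : ∀ b, t₀ ≤ b → ∀ α : ℝ → E, α t₀ = x₀ → IsIntegralCurveOn α g (Icc t₀ b) → b ≤ M) :
    ∃ T > t₀, ∃ α : ℝ → E, α t₀ = x₀ ∧ IsIntegralCurveOn α g (Ico t₀ T) ∧
      Tendsto (fun t => ‖α t‖) (𝓝[<] T) atTop ∧
      ∀ b, t₀ ≤ b → ∀ β : ℝ → E, β t₀ = x₀ → IsIntegralCurveOn β g (Icc t₀ b) →
        b < T ∧ EqOn β α (Icc t₀ b) := by
  set S : Set ℝ := {b | t₀ ≤ b ∧ ∃ α : ℝ → E, α t₀ = x₀ ∧ IsIntegralCurveOn α g (Icc t₀ b)}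
    with hS
  have hbdd : BddAbove S := ⟨M, fun b ⟨hb, α, h₁, h₂⟩ => hM b hb α h₁ h₂⟩
  have hext : ∀ (t : ℝ) (x : E), ∃ ε > 0, ∀ s ∈ Icc (t - ε) (t + ε), t₀ ≤ s → ∀ α : ℝ → E,
      α t₀ = x₀ → IsIntegralCurveOn α g (Icc t₀ s) → α s ∈ Metric.closedBall x ε →
      t + ε ∈ S := by
    intro t x
    obtain ⟨ε, hε, h⟩ := exists_isIntegralCurveOn_Icc hg hc t x
    refine ⟨ε, hε, fun s hs hs₀ α h₀ hα hαs => ?_⟩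
    obtain ⟨β, hβs, hβ⟩ := h s hs _ hαs
    refine ⟨hs₀.trans hs.2, fun r => if r ≤ s then α r else β r, by simpa [hs₀] using h₀, ?_⟩
    exact isIntegralCurveOn_ite_le hs₀ hs.2 hα (hβ.mono (Icc_subset_Icc_left hs.1)) hβs.symm
  have hmem : t₀ ∈ S := by
    refine ⟨le_rfl, fun _ => x₀, rfl, fun t ht => ?_⟩
    rw [Icc_self] at ht ⊢
    rw [mem_singleton_iff.1 ht]
    exact HasFDerivWithinAt.of_finite (finite_singleton _)
  have hgt : ∀ b ∈ S, ∃ b' ∈ S, b < b' := by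
    rintro b ⟨hb, α, h₀, hα⟩
    obtain ⟨ε, hε, h⟩ := hext b (α b)
    exact ⟨b + ε, h b ⟨by linarith, by linarith⟩ hb α h₀ hα (Metric.mem_closedBall_self hε.le),
      by linarith⟩
  set T := sSup S with hT
  have hlt : ∀ b ∈ S, b < T := fun b hb => by
    obtain ⟨b', hb', hbb'⟩ := hgt b hb
    exact hbb'.trans_le (le_csSup hbdd hb')
  have hdown : ∀ t, t₀ ≤ t → t < T → t ∈ S := fun t ht htT => by
    obtain ⟨b, ⟨_, α, h₀, hα⟩, htb⟩ := exists_lt_of_lt_csSup ⟨t₀, hmem⟩ htT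
    exact ⟨ht, α, h₀, hα.mono (Icc_subset_Icc_right htb.le)⟩
  choose! γ hγ₀ hγ using fun (b : ℝ) (hb : b ∈ S) => hb.2
  have heq : ∀ b, t₀ ≤ b → ∀ β : ℝ → E, β t₀ = x₀ → IsIntegralCurveOn β g (Icc t₀ b) →
      EqOn β (fun t => γ t t) (Icc t₀ b) := by
    intro b hb β hβ₀ hβ t ht
    have htS : t ∈ S := ⟨ht.1, β, hβ₀, hβ.mono (Icc_subset_Icc_right ht.2)⟩
    exact eqOn_Icc_of_isIntegralCurveOn hg (hβ.mono (Icc_subset_Icc_right ht.2)) (hγ t htS)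
      (hβ₀.trans (hγ₀ t htS).symm) ⟨ht.1, le_rfl⟩
  have hcurve : ∀ b ∈ S, IsIntegralCurveOn (fun t => γ t t) g (Icc t₀ b) := fun b hb t ht => by
    have e := heq b hb.1 (γ b) (hγ₀ b hb) (hγ b hb)
    have := (hγ b hb t ht).congr e.symm (e ht).symm
    rwa [e ht] at this
  refine ⟨T, hlt t₀ hmem, fun t => γ t t, hγ₀ t₀ hmem, fun t ht => ?_, ?_,
    fun b hb β hβ₀ hβ => ⟨hlt b ⟨hb, β, hβ₀, hβ⟩, heq b hb β hβ₀ hβ⟩⟩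
  · obtain ⟨b, hbt, hbT⟩ := exists_between ht.2
    have hb := hdown b (ht.1.trans hbt.le) hbT
    refine (hcurve b hb t ⟨ht.1, hbt.le⟩).mono_of_mem_nhdsWithin ?_
    filter_upwards [self_mem_nhdsWithin, mem_nhdsWithin_of_mem_nhds (Iio_mem_nhds hbt)]
      with r hr hr' using ⟨hr.1, le_of_lt hr'⟩
  · -- Otherwise the solution has a cluster point at `T`, and it can be continued beyond `T`.
    by_contra hnot
    rw [tendsto_atTop] at hnot
    push Not at hnot
    obtain ⟨R, hR⟩ := hnot
    have hfr : ∃ᶠ t in 𝓝[<] T, γ t t ∈ Metric.closedBall (0 : E) R := by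
      refine hR.mono fun t ht => ?_
      simpa using ht.le
    obtain ⟨x, -, hx⟩ := (isCompact_closedBall (0 : E) R).exists_mapClusterPt_of_frequently hfr
    obtain ⟨ε, hε, h⟩ := hext T x
    have hev : ∀ᶠ t in 𝓝[<] T, t ∈ Ico (max t₀ (T - ε)) T :=
      Ico_mem_nhdsLT (max_lt (hlt t₀ hmem) (by linarith))
    obtain ⟨t, htx, ht⟩ :=
      ((hx.frequently (Metric.closedBall_mem_nhds x hε)).and_eventually hev).exists
    have h₁ : t₀ ≤ t := (le_max_left _ _).trans ht.1
    have h₂ : T - ε ≤ t := (le_max_right _ _).trans ht.1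
    have := hlt _ (h t ⟨h₂, by linarith [ht.2]⟩ h₁ (fun t => γ t t)
      (hγ₀ t₀ hmem) (hcurve t (hdown t h₁ ht.2)) htx)
    linarith

end ODE

/-! ### A differential inequality that forces blow-up -/

/-- If `W' ≥ k U(W)` with `U > 0`, then the integral of `k` is bounded by that of `1 / U`: the
function `t ↦ ∫ v in W a..W t, 1 / U v` grows at least at the rate `k`. -/
theorem integral_le_integral_Ioi_of_mul_le_deriv {k U W W' : ℝ → ℝ} {a b : ℝ} (hab : a ≤ b)
    (hk : ContinuousOn k (Icc a b)) (hU : ContinuousOn U (Ioi 0)) (hUpos : ∀ v, 0 < v → 0 < U v)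
    (hW : ∀ t ∈ Icc a b, 0 < W t) (hUint : MeasureTheory.IntegrableOn (fun v => 1 / U v) (Ioi (W a)))
    (hd : ∀ t ∈ Icc a b, HasDerivWithinAt W (W' t) (Icc a b) t)
    (hle : ∀ t ∈ Icc a b, k t * U (W t) ≤ W' t) :
    ∫ t in a..b, k t ≤ ∫ v in Ioi (W a), 1 / U v := by
  have hinv : ContinuousOn (fun v => 1 / U v) (Ioi 0) :=
    continuousOn_const.div hU fun v hv => (hUpos v hv).ne'
  have ha : a ∈ Icc a b := ⟨le_rfl, hab⟩
  have hb : b ∈ Icc a b := ⟨hab, le_rfl⟩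
  have hV : ∀ w, 0 < w → HasDerivAt (fun w => ∫ v in W a..w, 1 / U v) (1 / U w) w := by
    intro w hw
    have hsub : uIcc (W a) w ⊆ Ioi 0 := fun v hv =>
      (lt_min (hW a ha) hw).trans_le hv.1
    exact intervalIntegral.integral_hasDerivAt_right (hinv.mono hsub).intervalIntegrable
      (hinv.stronglyMeasurableAtFilter isOpen_Ioi w hw) (hinv.continuousAt (Ioi_mem_nhds hw))
  have hcomp : ∀ t ∈ Icc a b, HasDerivWithinAt (fun t => ∫ v in W a..W t, 1 / U v)
      (1 / U (W t) * W' t) (Icc a b) t := fun t ht =>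
    (hV (W t) (hW t ht)).comp_hasDerivWithinAt t (hd t ht)
  have h₁ := intervalIntegral.integral_le_sub_of_hasDeriv_right_of_le hab
    (fun t ht => (hcomp t ht).continuousWithinAt)
    (fun t ht => (hasDerivWithinAt_Ici_of_Icc (hcomp t (Ioo_subset_Icc_self ht))
      (Ioo_subset_Ico_self ht)).mono Ioi_subset_Ici_self)
    hk.integrableOn_Icc (fun t ht => by
      have ht' := Ioo_subset_Icc_self ht
      have hp := hUpos _ (hW t ht')
      rw [one_div, inv_mul_eq_div, le_div_iff₀ hp]
      exact hle t ht')
  simp only [intervalIntegral.integral_same, sub_zero] at h₁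
  refine h₁.trans ?_
  have hpos : ∀ v ∈ Ioi (W a), 0 ≤ 1 / U v := fun v hv =>
    (one_div_pos.2 (hUpos v ((hW a ha).trans hv))).le
  rcases le_total (W a) (W b) with h | h
  · rw [intervalIntegral.integral_of_le h]
    exact MeasureTheory.setIntegral_mono_set hUint
      ((MeasureTheory.ae_restrict_iff' measurableSet_Ioi).2 (Eventually.of_forall hpos))
      (Ioc_subset_Ioi_self.eventuallyLE)
  · rw [intervalIntegral.integral_of_ge h]
    have h₂ : 0 ≤ ∫ v in Ioc (W b) (W a), 1 / U v :=
      MeasureTheory.setIntegral_nonneg measurableSet_Ioc fun v hv =>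
        (one_div_pos.2 (hUpos v ((hW b hb).trans hv.1))).le
    have h₃ : 0 ≤ ∫ v in Ioi (W a), 1 / U v :=
      MeasureTheory.setIntegral_nonneg measurableSet_Ioi hpos
    linarith

/-! ### Consequences of basis invertibility -/

section BasisInvertible

variable {W Z : Type*} [NormedAddCommGroup W] [NormedSpace ℝ W] [NormedAddCommGroup Z]
  [NormedSpace ℝ Z] {Φ : W → W →L[ℝ] Z}

theorem IsBasisInvertibleOn.isInvertible {S : Set W} (h : IsBasisInvertibleOn Φ S) {u : W}
    (hu : u ∈ S) : (Φ u).IsInvertible := by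
  obtain ⟨Θ, hΘ, hinv⟩ := h
  have := hinv (fun _ => u) fun _ => hu
  rwa [show ∑ k, Θ k ∘L Φ u = (∑ k, Θ k) ∘L Φ u by ext; simp, hΘ.sum_eq,
    ContinuousLinearMap.one_def, ContinuousLinearMap.id_comp] at this

/-- A map with basis invertible derivative on a segment takes different values at its ends. The
mean value theorem, which fails for vector-valued maps, is applied to each of the components
`Θ_k ∘ ψ`, whose values lie in a line; the intermediate points depend on `k`. -/
theorem IsBasisInvertibleOn.eq_of_apply_eq [FiniteDimensional ℝ Z] {ψ : W → Z}
    (hψ : ∀ u, HasFDerivAt ψ (Φ u) u) {u u' : W}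
    (h : IsBasisInvertibleOn Φ (convexHull ℝ {u, u'})) (he : ψ u = ψ u') : u = u' := by
  obtain ⟨Θ, hΘ, hinv⟩ := h
  have key : ∀ k, ∃ w ∈ convexHull ℝ {u, u'}, Θ k (Φ w (u' - u)) = 0 := by
    intro k
    let e : LinearMap.range (Θ k : Z →ₗ[ℝ] Z) ≃ₗ[ℝ] ℝ :=
      LinearEquiv.ofFinrankEq _ _ (by rw [hΘ.rank_one k, Module.finrank_self])
    let ℓ : Z →L[ℝ] ℝ :=
      ((e : _ →ₗ[ℝ] ℝ) ∘ₗ (Θ k : Z →ₗ[ℝ] Z).rangeRestrict).toContinuousLinearMap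
    have hline : ∀ s : ℝ, HasDerivAt (fun s : ℝ => u + s • (u' - u)) (u' - u) s := fun s => by
      simpa using ((hasDerivAt_id s).smul_const (u' - u)).const_add u
    have hd : ∀ s : ℝ, HasDerivAt (fun s : ℝ => ℓ (ψ (u + s • (u' - u))))
        (ℓ (Φ (u + s • (u' - u)) (u' - u))) s := fun s =>
      ℓ.hasFDerivAt.comp_hasDerivAt s ((hψ _).comp_hasDerivAt s (hline s))
    obtain ⟨s, hs, hs₀⟩ := exists_hasDerivAt_eq_zero (zero_lt_one' ℝ)
      (fun s _ => (hd s).continuousAt.continuousWithinAt) (by simp [he]) fun s _ => hd s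
    refine ⟨u + s • (u' - u), ?_, ?_⟩
    · rw [convexHull_pair, segment_eq_image']
      exact ⟨s, Ioo_subset_Icc_self hs, rfl⟩
    · have h₁ : e ((Θ k : Z →ₗ[ℝ] Z).rangeRestrict (Φ (u + s • (u' - u)) (u' - u))) = 0 := hs₀
      rw [LinearEquiv.map_eq_zero_iff] at h₁
      exact congrArg Subtype.val h₁
  choose w hw hw₀ using key
  obtain ⟨L, hL⟩ := hinv w hw
  have : L (u' - u) = 0 := by
    rw [← ContinuousLinearEquiv.coe_coe, hL, sum_apply]
    exact Finset.sum_eq_zero fun k _ => hw₀ k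
  exact (sub_eq_zero.1 (L.map_eq_zero_iff.1 this)).symm

end BasisInvertible

/-! ### The algebra of the projectors -/

section Algebra

variable {n : ℕ} {A B : Rn n →L[ℝ] Rn n} (h : IsIndexOnePencil A B)

theorem P₁_coe (v : X₁ A B) : P₁ h v = v :=
  Submodule.projectionOnto_apply_left h.isCompl_X v

theorem P₁_eq_zero_iff {x : Rn n} : P₁ h x = 0 ↔ x ∈ X₂ A :=
  Submodule.projectionOnto_apply_eq_zero_iff h.isCompl_X

theorem Q₂_eq_zero_iff {y : Rn n} : Q₂ h y = 0 ↔ y ∈ Y₁ A :=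
  Submodule.projectionOnto_apply_eq_zero_iff h.isCompl_Y.symm

theorem P₁_add_P₂ (x : Rn n) : (P₁ h x : Rn n) + P₂ h x = x :=
  Submodule.projection_add_projection_eq_self h.isCompl_X x

theorem Q₁_add_Q₂ (y : Rn n) : (Q₁ h y : Rn n) + Q₂ h y = y :=
  Submodule.projection_add_projection_eq_self h.isCompl_Y y

theorem Q₂_B_coe (u : X₂ A) : Q₂ h (B u) = B₂ A B u :=
  Submodule.projectionOnto_apply_left h.isCompl_Y.symm (B₂ A B u)

theorem Q₂_B (x : Rn n) : (Q₂ h (B x) : Rn n) = B (P₂ h x) := by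
  have h₁ : Q₂ h (B (P₁ h x)) = 0 := (Q₂_eq_zero_iff h).2 (P₁ h x).2
  conv_lhs => rw [← P₁_add_P₂ h x, map_add, map_add, h₁, zero_add, Q₂_B_coe]
  rfl

theorem A_P₁ (x : Rn n) : A (P₁ h x) = A x := by
  have h₂ : A (P₂ h x) = 0 := (P₂ h x).2
  conv_rhs => rw [← P₁_add_P₂ h x, map_add, h₂, add_zero]

theorem Ginv_A (x : Rn n) : Ginv h (A x) = P₁ h x := by
  have h₂ : P₂ h (P₁ h x) = 0 :=
    (Submodule.projectionOnto_apply_eq_zero_iff h.isCompl_X.symm).2 (P₁ h x).2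
  have hG : G h (P₁ h x) = A x := by
    change A (P₁ h x) + B (P₂ h (P₁ h x)) = A x
    rw [h₂, A_P₁, ZeroMemClass.coe_zero, map_zero, add_zero]
  rw [← hG]
  exact (LinearEquiv.ofInjectiveEndo (G h : Rn n →ₗ[ℝ] Rn n) (G_injective h)).symm_apply_apply _

theorem coe_P₁_Ginv {y : Rn n} (hy : y ∈ Y₁ A) : (P₁ h (Ginv h y) : Rn n) = Ginv h y := by
  obtain ⟨x, rfl⟩ := hy
  rw [ContinuousLinearMap.coe_coe, Ginv_A, P₁_coe]

theorem A_P₁_Ginv {y : Rn n} (hy : y ∈ Y₁ A) : A (P₁ h (Ginv h y)) = y := by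
  obtain ⟨x, rfl⟩ := hy
  rw [ContinuousLinearMap.coe_coe, Ginv_A, P₁_coe, A_P₁]

theorem neg_B_P₁_add_Q₁ {x y : Rn n} (hxy : Q₂ h (y - B x) = 0) :
    -(B (P₁ h x)) + Q₁ h y = y - B x := by
  have h₁ : (Q₂ h y : Rn n) = B (P₂ h x) := by
    rw [map_sub, sub_eq_zero] at hxy
    rw [hxy, Q₂_B]
  have h₂ := Q₁_add_Q₂ h y
  have h₃ : B x = B (P₁ h x) + B (P₂ h x) := by rw [← map_add, P₁_add_P₂]
  rw [h₃, ← h₁]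
  nth_rewrite 2 [← h₂]
  abel

end Algebra

/-! ### Solving the algebraic equation -/

section Constraint

variable {n : ℕ} {A B : Rn n →L[ℝ] Rn n}

/-- The assumptions on the right-hand side `f` that reduce the equation `d/dt [A x] + B x = f(t, x)`
to an ordinary differential equation in `X₁`. -/
structure IsAdmissible (h : IsIndexOnePencil A B) (f : ℝ → Rn n → Rn n) : Prop where
  continuousOn : ContinuousOn (fun p : ℝ × Rn n => f p.1 p.2) (Ici 0 ×ˢ univ)
  differentiable : ∀ t : ℝ, 0 ≤ t → Differentiable ℝ (f t)
  continuousOn_fderiv :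
    ContinuousOn (fun p : ℝ × Rn n => fderiv ℝ (f p.1) p.2) (Ici 0 ×ˢ univ)
  exists_mem_L₀ : ∀ t : ℝ, 0 ≤ t → ∀ v : X₁ A B, ∃ u : X₂ A, (t, (v + u : Rn n)) ∈ L₀ h f
  isBasisInvertibleOn : ∀ t : ℝ, 0 ≤ t → ∀ (v : X₁ A B) (u u' : X₂ A),
    (t, (v + u : Rn n)) ∈ L₀ h f → (t, (v + u' : Rn n)) ∈ L₀ h f →
      IsBasisInvertibleOn (Φ h f t v) (convexHull ℝ {u, u'})

/-- The map `x ↦ (P₁ x, Q₂ [f(t, x) - B x])` from `ℝⁿ` to `X₁ × Y₂`. The point `(t, x)` is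
consistent if and only if the second component vanishes. So that the map is defined for all real
`t`, the function `f` is extended by `f(t, x) = f(0, x)` to `t < 0`. -/
noncomputable def splitMap (h : IsIndexOnePencil A B) (f : ℝ → Rn n → Rn n) (t : ℝ) (x : Rn n) :
    X₁ A B × Y₂ A B :=
  (P₁ h x, Q₂ h (f (max t 0) x - B x))

variable {h : IsIndexOnePencil A B} {f : ℝ → Rn n → Rn n}

theorem mem_L₀_iff {t : ℝ} {x : Rn n} : (t, x) ∈ L₀ h f ↔ 0 ≤ t ∧ Q₂ h (f t x - B x) = 0 := by
  rw [← neg_sub (B x), map_neg, neg_eq_zero]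
  rfl

theorem splitMap_eq_iff {t : ℝ} (ht : 0 ≤ t) {x : Rn n} {z : X₁ A B} :
    splitMap h f t x = (z, 0) ↔ P₁ h x = z ∧ (t, x) ∈ L₀ h f := by
  rw [splitMap, max_eq_left ht, Prod.mk.injEq, mem_L₀_iff]
  simp [ht]

theorem splitMap_max (t : ℝ) (x : Rn n) : splitMap h f (max t 0) x = splitMap h f t x := by
  simp [splitMap]

namespace IsAdmissible

theorem continuous_extend (hf : IsAdmissible h f) : Continuous fun p : ℝ × Rn n => f (max p.1 0) p.2 :=
  hf.continuousOn.comp_continuous (f := fun p : ℝ × Rn n => (max p.1 0, p.2)) (by fun_prop)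
    fun p => ⟨le_max_right p.1 0, trivial⟩

theorem continuous_fderiv_extend (hf : IsAdmissible h f) :
    Continuous fun p : ℝ × Rn n => fderiv ℝ (f (max p.1 0)) p.2 :=
  hf.continuousOn_fderiv.comp_continuous (f := fun p : ℝ × Rn n => (max p.1 0, p.2)) (by fun_prop)
    fun p => ⟨le_max_right p.1 0, trivial⟩

theorem hasFDerivAt_constraint (hf : IsAdmissible h f) (t : ℝ) (ht : 0 ≤ t) (v : X₁ A B) (u : X₂ A) :
    HasFDerivAt (fun u : X₂ A => Q₂ h (f t (v + u : Rn n) - B (v + u : Rn n))) (Φ h f t v u) u := by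
  have h₁ : HasFDerivAt (fun x => Q₂ h (f t x)) (fderiv ℝ (fun x => Q₂ h (f t x)) (v + u : Rn n))
      (v + u : Rn n) :=
    (((Q₂ h).differentiable.comp (hf.differentiable t ht)) _).hasFDerivAt
  have h₂ : HasFDerivAt (fun u : X₂ A => (v + u : Rn n)) (X₂ A).subtypeL u :=
    (X₂ A).subtypeL.hasFDerivAt.const_add _
  have h₃ := (h₁.comp u h₂).sub (B₂ A B).hasFDerivAt
  refine h₃.congr_of_eventuallyEq (Eventually.of_forall fun w => ?_)
  have h₄ : Q₂ h (B v) = 0 := (Q₂_eq_zero_iff h).2 v.2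
  simp [map_sub, map_add, h₄, Q₂_B_coe]

theorem eq_of_splitMap_eq (hf : IsAdmissible h f) {t : ℝ} {x y : Rn n} {z : X₁ A B} (hx : splitMap h f t x = (z, 0))
    (hy : splitMap h f t y = (z, 0)) : x = y := by
  have ht : 0 ≤ max t 0 := le_max_right _ _
  rw [← splitMap_max, splitMap_eq_iff ht] at hx hy
  have ex : x = z + P₂ h x := by rw [← hx.1, P₁_add_P₂]
  have ey : y = z + P₂ h y := by rw [← hy.1, P₁_add_P₂]
  have hx' := hx.2
  have hy' := hy.2
  rw [ex] at hx'
  rw [ey] at hy'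
  have := (hf.isBasisInvertibleOn _ ht z _ _ hx' hy').eq_of_apply_eq
    (hf.hasFDerivAt_constraint _ ht z)
    ((mem_L₀_iff.1 hx').2.trans (mem_L₀_iff.1 hy').2.symm)
  rw [ex, ey, this]

theorem exists_splitMap_eq (hf : IsAdmissible h f) (t : ℝ) (z : X₁ A B) : ∃ x, splitMap h f t x = (z, 0) := by
  have ht : 0 ≤ max t 0 := le_max_right _ _
  obtain ⟨u, hu⟩ := hf.exists_mem_L₀ _ ht z
  refine ⟨z + u, ?_⟩
  rw [← splitMap_max, splitMap_eq_iff ht, map_add, P₁_coe, (P₁_eq_zero_iff h).2 u.2, add_zero]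
  exact ⟨rfl, hu⟩

theorem hasFDerivAt_splitMap (hf : IsAdmissible h f) (t : ℝ) (x : Rn n) : HasFDerivAt (splitMap h f t)
    ((P₁ h).prod (Q₂ h ∘L (fderiv ℝ (f (max t 0)) x - B))) x :=
  (P₁ h).hasFDerivAt.prodMk <| (Q₂ h).hasFDerivAt.comp x <|
    (hf.differentiable _ (le_max_right _ _) x).hasFDerivAt.sub B.hasFDerivAt

theorem continuous_fderiv_splitMap (hf : IsAdmissible h f) :
    Continuous fun p : ℝ × Rn n => fderiv ℝ (splitMap h f p.1) p.2 := by
  have : (fun p : ℝ × Rn n => fderiv ℝ (splitMap h f p.1) p.2) = fun p =>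
      (P₁ h).prod (Q₂ h ∘L (fderiv ℝ (f (max p.1 0)) p.2 - B)) :=
    funext fun p => (hf.hasFDerivAt_splitMap p.1 p.2).fderiv
  rw [this]
  have h₁ : Continuous fun p : ℝ × Rn n => Q₂ h ∘L (fderiv ℝ (f (max p.1 0)) p.2 - B) :=
    ((ContinuousLinearMap.compL ℝ (Rn n) (Rn n) (Y₂ A B)) (Q₂ h)).continuous.comp
      (hf.continuous_fderiv_extend.sub continuous_const)
  exact (ContinuousLinearMap.prodₗᵢ ℝ).continuous.comp (continuous_const.prodMk h₁)

/-- The derivative of `x ↦ (P₁ x, Q₂ [f(t, x) - B x])` at a consistent point is invertible: its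
restriction to `Ker P₁ = X₂` is `Φ`, an isomorphism onto `Y₂`. -/
theorem exists_equiv_eq_fderiv_splitMap (hf : IsAdmissible h f) {t : ℝ} {x : Rn n} {z : X₁ A B}
    (hx : splitMap h f t x = (z, 0)) :
    ∃ L : Rn n ≃L[ℝ] X₁ A B × Y₂ A B,
      (L : Rn n →L[ℝ] X₁ A B × Y₂ A B) = fderiv ℝ (splitMap h f t) x := by
  have ht : 0 ≤ max t 0 := le_max_right _ _
  rw [← splitMap_max, splitMap_eq_iff ht] at hx
  have ex : x = z + P₂ h x := by rw [← hx.1, P₁_add_P₂]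
  have hx' := hx.2
  rw [ex] at hx'
  obtain ⟨L, hL⟩ := (hf.isBasisInvertibleOn _ ht z _ _ hx' hx').isInvertible
    (subset_convexHull ℝ _ (mem_insert _ _))
  set D : Rn n →L[ℝ] X₁ A B × Y₂ A B := fderiv ℝ (splitMap h f t) x with hD
  rw [(hf.hasFDerivAt_splitMap t x).fderiv] at hD
  have hΦ : ∀ u : X₂ A, Q₂ h (fderiv ℝ (f (max t 0)) x u - B u) = L u := by
    intro u
    have h₁ : HasFDerivAt (fun u : X₂ A => Q₂ h (f (max t 0) (z + u : Rn n) - B (z + u : Rn n)))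
        ((Q₂ h ∘L (fderiv ℝ (f (max t 0)) x - B)) ∘L (X₂ A).subtypeL) (P₂ h x) := by
      refine HasFDerivAt.comp (g := fun y => Q₂ h (f (max t 0) y - B y)) (P₂ h x) ?_
        ((X₂ A).subtypeL.hasFDerivAt.const_add _)
      change HasFDerivAt _ _ ((z : Rn n) + (P₂ h x : Rn n))
      rw [← ex]
      exact (hf.hasFDerivAt_splitMap t x).snd
    have h₂ := h₁.unique (hf.hasFDerivAt_constraint _ ht z (P₂ h x))
    rw [← hL] at h₂
    exact congrArg (fun T : X₂ A →L[ℝ] Y₂ A B => T u) h₂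
  have hinj : Function.Injective D := by
    rw [injective_iff_map_eq_zero]
    intro y hy
    rw [hD] at hy
    have h₁ : P₁ h y = 0 := congrArg Prod.fst hy
    have h₂ : Q₂ h (fderiv ℝ (f (max t 0)) x y - B y) = 0 := congrArg Prod.snd hy
    have hy' := (P₁_eq_zero_iff h).1 h₁
    have := (hΦ ⟨y, hy'⟩).symm.trans h₂
    exact congrArg Subtype.val (L.map_eq_zero_iff.1 this)
  have hdim : Module.finrank ℝ (Rn n) = Module.finrank ℝ (X₁ A B × Y₂ A B) := by
    rw [Module.finrank_prod, ← L.toLinearEquiv.finrank_eq,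
      Submodule.finrank_add_eq_of_isCompl h.isCompl_X]
  refine ⟨(LinearEquiv.ofInjectiveOfFinrankEq (D : Rn n →ₗ[ℝ] _) hinj hdim).toContinuousLinearEquiv,
    ?_⟩
  ext1 y
  rfl

/-- The unique point `x` with `P₁ x = z` that is consistent at the time `t` (for `t < 0`, at the
time `0`). -/
noncomputable def consistentPoint (hf : IsAdmissible h f) (t : ℝ) (z : X₁ A B) : Rn n :=
  (hf.exists_splitMap_eq t z).choose

theorem splitMap_consistentPoint (hf : IsAdmissible h f) (t : ℝ) (z : X₁ A B) :
    splitMap h f t (hf.consistentPoint t z) = (z, 0) :=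
  (hf.exists_splitMap_eq t z).choose_spec

theorem P₁_consistentPoint (hf : IsAdmissible h f) (t : ℝ) (z : X₁ A B) : P₁ h (hf.consistentPoint t z) = z :=
  congrArg Prod.fst (hf.splitMap_consistentPoint t z)

theorem consistentPoint_mem_L₀ (hf : IsAdmissible h f) {t : ℝ} (ht : 0 ≤ t) (z : X₁ A B) :
    (t, hf.consistentPoint t z) ∈ L₀ h f :=
  ((splitMap_eq_iff ht).1 (hf.splitMap_consistentPoint t z)).2

theorem consistentPoint_P₁ (hf : IsAdmissible h f) {t : ℝ} {x : Rn n} (hx : (t, x) ∈ L₀ h f) :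
    hf.consistentPoint t (P₁ h x) = x :=
  hf.eq_of_splitMap_eq (hf.splitMap_consistentPoint t _) ((splitMap_eq_iff hx.1).2 ⟨rfl, hx⟩)

theorem exists_antilipschitz_splitMap (hf : IsAdmissible h f) (t : ℝ) (z : X₁ A B) :
    (∃ K : ℝ≥0, ∃ V ∈ 𝓝 (hf.consistentPoint t z), ∀ᶠ s in 𝓝 t, ∀ x ∈ V, ∀ y ∈ V,
        dist x y ≤ K * dist (splitMap h f s x) (splitMap h f s y)) ∧
      ∀ V ∈ 𝓝 (hf.consistentPoint t z), ∀ᶠ p in 𝓝 (t, ((z, 0) : X₁ A B × Y₂ A B)),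
        ∃ x ∈ V, splitMap h f p.1 x = p.2 := by
  obtain ⟨L, hL⟩ := hf.exists_equiv_eq_fderiv_splitMap (hf.splitMap_consistentPoint t z)
  have hN : Continuous fun s => splitMap h f s (hf.consistentPoint t z) := by
    refine continuous_const.prodMk ((Q₂ h).continuous.comp (Continuous.sub ?_ continuous_const))
    exact hf.continuous_extend.comp
      (by fun_prop : Continuous fun s : ℝ => (s, hf.consistentPoint t z))
  have := exists_antilipschitz_and_eventually_exists_eq
    (fun s x => (hf.hasFDerivAt_splitMap s x).differentiableAt) hN.continuousAt
    hf.continuous_fderiv_splitMap.continuousAt L hL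
  rwa [hf.splitMap_consistentPoint] at this

theorem continuous_consistentPoint (hf : IsAdmissible h f) :
    Continuous fun p : ℝ × X₁ A B => hf.consistentPoint p.1 p.2 := by
  refine continuous_iff_continuousAt.2 fun ⟨t, z⟩ => fun V hV => ?_
  have h₁ := (hf.exists_antilipschitz_splitMap t z).2 V hV
  have h₂ : ContinuousAt (fun p : ℝ × X₁ A B => (p.1, ((p.2, 0) : X₁ A B × Y₂ A B))) (t, z) := by
    fun_prop
  rw [mem_map]
  filter_upwards [h₂.eventually h₁] with p ⟨x, hxV, hx⟩
  rw [mem_preimage]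
  rwa [hf.eq_of_splitMap_eq (hf.splitMap_consistentPoint p.1 p.2) hx]

theorem locallyLipschitzUniformly_consistentPoint (hf : IsAdmissible h f) :
    LocallyLipschitzUniformly hf.consistentPoint := by
  intro t z
  obtain ⟨K, V, hV, hK⟩ := (hf.exists_antilipschitz_splitMap t z).1
  have hev : ∀ᶠ p : ℝ × X₁ A B in 𝓝 t ×ˢ 𝓝 z, hf.consistentPoint p.1 p.2 ∈ V := by
    rw [← nhds_prod_eq]
    exact hf.continuous_consistentPoint.continuousAt.eventually hV
  obtain ⟨p, hp, q, hq, hpq⟩ := eventually_prod_iff.1 hev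
  refine ⟨K, {z | q z}, hq, ?_⟩
  filter_upwards [hK, hp] with s hs hps
  refine LipschitzOnWith.of_dist_le_mul fun y hy y' hy' => ?_
  have := hs _ (hpq hps hy) _ (hpq hps hy')
  rw [splitMap_consistentPoint, splitMap_consistentPoint] at this
  simpa [Prod.dist_eq] using this

/-! ### The reduced differential equation in `X₁` -/

/-- The right-hand side of the equation `z' = G⁻¹ [-B z + Q₁ f(t, x)]` for `z = P₁ x`, where `x` is
the consistent point over `z`. The values of `G⁻¹` on `Y₁` lie in `X₁`; the projector `P₁` only
makes them elements of this subspace. -/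
noncomputable def reducedField (hf : IsAdmissible h f) (t : ℝ) (z : X₁ A B) : X₁ A B :=
  P₁ h (Ginv h (-(B (z : Rn n)) + (Q₁ h (f (max t 0) (hf.consistentPoint t z)) : Rn n)))

theorem continuous_reducedField (hf : IsAdmissible h f) :
    Continuous fun p : ℝ × X₁ A B => hf.reducedField p.1 p.2 := by
  have h₁ : Continuous fun p : ℝ × X₁ A B => f (max p.1 0) (hf.consistentPoint p.1 p.2) :=
    hf.continuous_extend.comp (continuous_fst.prodMk hf.continuous_consistentPoint)
  exact (P₁ h).continuous.comp <| (Ginv h).continuous.comp <|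
    (B.continuous.comp (continuous_subtype_val.comp continuous_snd)).neg.add
      (continuous_subtype_val.comp ((Q₁ h).continuous.comp h₁))

theorem locallyLipschitzUniformly_reducedField (hf : IsAdmissible h f) : LocallyLipschitzUniformly hf.reducedField := by
  have h₁ : LocallyLipschitzUniformly fun t : ℝ => f (max t 0) :=
    .of_continuous_fderiv (fun t => hf.differentiable _ (le_max_right _ _))
      hf.continuous_fderiv_extend
  have h₂ := h₁.comp hf.locallyLipschitzUniformly_consistentPoint hf.continuous_consistentPoint
  let T : Rn n →L[ℝ] X₁ A B := P₁ h ∘L Ginv h ∘L (Y₁ A).subtypeL ∘L Q₁ h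
  let S : X₁ A B →L[ℝ] X₁ A B := -(P₁ h ∘L Ginv h ∘L B ∘L (X₁ A B).subtypeL)
  have hT : LocallyLipschitzUniformly fun (t : ℝ) z => T (f (max t 0) (hf.consistentPoint t z)) :=
    LocallyLipschitzUniformly.comp (N := fun (_ : ℝ) x => T x)
      (.of_lipschitzWith fun _ => T.lipschitz) h₂
      (hf.continuous_extend.comp (continuous_fst.prodMk hf.continuous_consistentPoint))
  have hS : LocallyLipschitzUniformly fun (_ : ℝ) z => S z := .of_lipschitzWith fun _ => S.lipschitz
  convert hS.add hT using 3 with t z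
  simp [reducedField, S, T]

theorem reducedField_P₁ (hf : IsAdmissible h f) {t : ℝ} {x : Rn n} (hx : (t, x) ∈ L₀ h f) :
    hf.reducedField t (P₁ h x) = P₁ h (Ginv h (f t x - B x)) := by
  rw [reducedField, hf.consistentPoint_P₁ hx, max_eq_left hx.1,
    neg_B_P₁_add_Q₁ h (mem_L₀_iff.1 hx).2]

theorem coe_reducedField_P₁ (hf : IsAdmissible h f) {t : ℝ} {x : Rn n} (hx : (t, x) ∈ L₀ h f) :
    (hf.reducedField t (P₁ h x) : Rn n) =
      Ginv h (-(B (P₁ h x : Rn n)) + (Q₁ h (f t x) : Rn n)) := by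
  have h₁ := (mem_L₀_iff.1 hx).2
  rw [hf.reducedField_P₁ hx, neg_B_P₁_add_Q₁ h h₁, coe_P₁_Ginv h ((Q₂_eq_zero_iff h).1 h₁)]

end IsAdmissible

theorem interval_coe (t₀ T : ℝ) : interval t₀ (T : EReal) = Ico t₀ T := by
  ext t
  simp [interval]

theorem uniqueDiffOn_interval {t₀ : ℝ} {t₁ : EReal} (ht : (t₀ : EReal) < t₁) :
    UniqueDiffOn ℝ (interval t₀ t₁) := by
  have hc : Convex ℝ (interval t₀ t₁) := by
    have : OrdConnected (interval t₀ t₁) := ⟨fun a ha b hb t ht =>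
      ⟨ha.1.trans ht.1, lt_of_le_of_lt (EReal.coe_le_coe_iff.2 ht.2) hb.2⟩⟩
    exact this.convex
  refine uniqueDiffOn_convex hc ?_
  obtain ⟨s, hs₀, hs⟩ := EReal.lt_iff_exists_real_btwn.1 ht
  have hsub : Ioo t₀ s ⊆ interval t₀ t₁ := fun t ht =>
    ⟨ht.1.le, (EReal.coe_lt_coe_iff.2 ht.2).trans hs⟩
  exact (nonempty_Ioo.2 (EReal.coe_lt_coe_iff.1 hs₀)).mono (interior_maximal hsub isOpen_Ioo)

theorem IsSolution.hasDerivWithinAt {t₀ : ℝ} {x₀ : Rn n} {t₁ : EReal} {x : ℝ → Rn n}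
    (hx : IsSolution A B f t₀ x₀ t₁ x) {t : ℝ} (ht : t ∈ interval t₀ t₁) :
    HasDerivWithinAt (fun s => A (x s)) (f t (x t) - B (x t)) (interval t₀ t₁) t := by
  rw [← hx.eqn t ht, add_sub_cancel_right]
  exact (hx.contDiffOn.differentiableOn one_ne_zero t ht).hasDerivWithinAt

theorem IsSolution.mem_L₀ (h : IsIndexOnePencil A B) {t₀ : ℝ} (ht₀ : 0 ≤ t₀) {x₀ : Rn n}
    {t₁ : EReal} {x : ℝ → Rn n} (hx : IsSolution A B f t₀ x₀ t₁ x) {t : ℝ}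
    (ht : t ∈ interval t₀ t₁) : (t, x t) ∈ L₀ h f := by
  refine mem_L₀_iff.2 ⟨ht₀.trans ht.1, ?_⟩
  have h₁ := (Q₂ h).hasFDerivAt.comp_hasDerivWithinAt t (hx.hasDerivWithinAt ht)
  have h₂ : (Q₂ h) ∘ (fun s => A (x s)) = fun _ => 0 :=
    funext fun s => (Q₂_eq_zero_iff h).2 ⟨x s, rfl⟩
  rw [h₂] at h₁
  exact (uniqueDiffOn_interval hx.lt t ht).eq_deriv _ h₁ (hasDerivWithinAt_const _ _ _)

theorem IsSolution.isIntegralCurveOn (hf : IsAdmissible h f) {t₀ : ℝ} (ht₀ : 0 ≤ t₀) {x₀ : Rn n}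
    {t₁ : EReal} {x : ℝ → Rn n} (hx : IsSolution A B f t₀ x₀ t₁ x) :
    IsIntegralCurveOn (fun t => P₁ h (x t)) hf.reducedField (interval t₀ t₁) := by
  intro t ht
  have h₁ := (P₁ h ∘L Ginv h).hasFDerivAt.comp_hasDerivWithinAt t (hx.hasDerivWithinAt ht)
  have h₂ : (P₁ h ∘L Ginv h) ∘ (fun s => A (x s)) = fun s => P₁ h (x s) := funext fun s => by
    change P₁ h (Ginv h (A (x s))) = P₁ h (x s)
    rw [Ginv_A, P₁_coe]
  rw [h₂, ContinuousLinearMap.comp_apply, ← hf.reducedField_P₁ (hx.mem_L₀ h ht₀ ht)] at h₁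
  exact h₁

theorem isSolution_of_isIntegralCurveOn (hf : IsAdmissible h f) {t₀ T : ℝ} (ht₀ : t₀ < T)
    {x₀ : Rn n} (hx₀ : (t₀, x₀) ∈ L₀ h f) {z : ℝ → X₁ A B} (hz₀ : z t₀ = P₁ h x₀)
    (hz : IsIntegralCurveOn z hf.reducedField (Ico t₀ T)) :
    IsSolution A B f t₀ x₀ (T : EReal) fun t => hf.consistentPoint t (z t) := by
  have hcont : ContinuousOn (fun t => hf.consistentPoint t (z t)) (Ico t₀ T) :=
    hf.continuous_consistentPoint.comp_continuousOn (f := fun t => (t, z t))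
      (continuousOn_id.prodMk hz.continuousOn)
  have hmem : ∀ t ∈ Ico t₀ T, (t, hf.consistentPoint t (z t)) ∈ L₀ h f := fun t ht =>
    hf.consistentPoint_mem_L₀ (hx₀.1.trans ht.1) _
  have hd : ∀ t ∈ Ico t₀ T, HasDerivWithinAt (fun s => A (hf.consistentPoint s (z s)))
      (f t (hf.consistentPoint t (z t)) - B (hf.consistentPoint t (z t))) (Ico t₀ T) t := by
    intro t ht
    have h₁ := (A ∘L (X₁ A B).subtypeL).hasFDerivAt.comp_hasDerivWithinAt t (hz t ht)
    have h₂ := hf.reducedField_P₁ (hmem t ht)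
    rw [hf.P₁_consistentPoint] at h₂
    have h₃ : (A ∘L (X₁ A B).subtypeL) (hf.reducedField t (z t)) =
        f t (hf.consistentPoint t (z t)) - B (hf.consistentPoint t (z t)) := by
      rw [h₂]
      exact A_P₁_Ginv h ((Q₂_eq_zero_iff h).1 (mem_L₀_iff.1 (hmem t ht)).2)
    rw [h₃] at h₁
    refine h₁.congr_of_mem (fun s _ => ?_) ht
    rw [← A_P₁ h, hf.P₁_consistentPoint]
    rfl
  have hud : UniqueDiffOn ℝ (Ico t₀ T) := by
    rw [← interval_coe]
    exact uniqueDiffOn_interval (EReal.coe_lt_coe_iff.2 ht₀)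
  have hderiv : EqOn (derivWithin (fun s => A (hf.consistentPoint s (z s))) (Ico t₀ T))
      (fun t => f t (hf.consistentPoint t (z t)) - B (hf.consistentPoint t (z t))) (Ico t₀ T) :=
    fun t ht => (hd t ht).derivWithin (hud t ht)
  constructor
  · exact EReal.coe_lt_coe_iff.2 ht₀
  · rwa [interval_coe]
  · rw [interval_coe, contDiffOn_one_iff_derivWithin hud]
    refine ⟨fun t ht => (hd t ht).differentiableWithinAt, ContinuousOn.congr ?_ hderiv⟩
    refine ContinuousOn.sub ?_ (B.continuous.comp_continuousOn hcont)
    exact hf.continuousOn.comp (continuousOn_id.prodMk hcont)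
      fun t ht => ⟨hx₀.1.trans ht.1, trivial⟩
  · intro t ht
    rw [interval_coe] at ht ⊢
    rw [hderiv ht, sub_add_cancel]
  · rw [hz₀, hf.consistentPoint_P₁ hx₀]

end Constraint

end SemilinearDAE

/-! ### The bound on the time of existence -/

open SemilinearDAE in
theorem theorem4p1 {n : ℕ} (A B : Rn n →L[ℝ] Rn n) (f : ℝ → Rn n → Rn n)
    -- `f` is continuous and has a continuous partial derivative in `x` on `[0, ∞) × ℝⁿ`
    (hf : ContinuousOn (fun p : ℝ × Rn n => f p.1 p.2) (Ici 0 ×ˢ univ))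
    (hfd : ∀ t : ℝ, 0 ≤ t → Differentiable ℝ (f t))
    (hf' : ContinuousOn (fun p : ℝ × Rn n => fderiv ℝ (f p.1) p.2) (Ici 0 ×ˢ univ))
    -- the pencil is regular of index one
    (hAB : IsIndexOnePencil A B)
    -- solvability of the consistency condition in `X₂`
    (hcons : ∀ t : ℝ, 0 ≤ t → ∀ v : X₁ A B, ∃ u : X₂ A, (t, (v + u : Rn n)) ∈ L₀ hAB f)
    -- basis invertibility
    (hΦ : ∀ t : ℝ, 0 ≤ t → ∀ (v : X₁ A B) (u u' : X₂ A),
      (t, (v + u : Rn n)) ∈ L₀ hAB f → (t, (v + u' : Rn n)) ∈ L₀ hAB f →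
        IsBasisInvertibleOn (Φ hAB f t v) (convexHull ℝ {u, u'}))
    -- the invariant set `Ω` in `X₁`
    (Ω : Set (X₁ A B)) (hΩ₀ : (0 : X₁ A B) ∉ Ω)
    (hΩ : ∀ (t₀ : ℝ) (x₀ : Rn n), (t₀, x₀) ∈ L₀ hAB f → P₁ hAB x₀ ∈ Ω →
      ∀ (t₁ : EReal) (x : ℝ → Rn n), IsSolution A B f t₀ x₀ t₁ x →
        ∀ t ∈ interval t₀ t₁, P₁ hAB (x t) ∈ Ω)
    -- the self-adjoint positive operator `H` and the functions `k`, `U`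
    (H : X₁ A B →L[ℝ] X₁ A B) (hH : IsSelfAdjoint H)
    (hHpos : ∀ v : X₁ A B, v ≠ 0 → 0 < inner ℝ (H v) v)
    (k U : ℝ → ℝ) (hk : ContinuousOn k (Ici 0))
    (hU : ContinuousOn U (Ioi 0)) (hUpos : ∀ v : ℝ, 0 < v → 0 < U v)
    (hUint : ∀ c : ℝ, 0 < c → MeasureTheory.IntegrableOn (fun v => 1 / U v) (Ioi c))
    (hkint : ∀ t₀ : ℝ, 0 ≤ t₀ → Tendsto (fun T : ℝ => ∫ t in t₀..T, k t) atTop atTop)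
    (hest : ∀ (t : ℝ) (x : Rn n), (t, x) ∈ L₀ hAB f → P₁ hAB x ∈ Ω →
      k t * U (1 / 2 * inner ℝ (H (P₁ hAB x)) (P₁ hAB x)) ≤
        inner ℝ (H (P₁ hAB x) : Rn n)
          (Ginv hAB (-(B (P₁ hAB x : Rn n)) + (Q₁ hAB (f t x) : Rn n)))) :
    -- there is a solution with a finite escape time `T`, and every solution is a restriction of it
    ∀ (t₀ : ℝ) (x₀ : Rn n), (t₀, x₀) ∈ L₀ hAB f → P₁ hAB x₀ ∈ Ω →
      ∃ (T : ℝ) (x : ℝ → Rn n), t₀ < T ∧ IsSolution A B f t₀ x₀ (T : EReal) x ∧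
        Tendsto (fun t => ‖x t‖) (𝓝[<] T) atTop ∧
        ∀ (t₁ : EReal) (y : ℝ → Rn n), IsSolution A B f t₀ x₀ t₁ y →
          t₁ ≤ (T : EReal) ∧ ∀ t ∈ interval t₀ t₁, y t = x t := by
  intro t₀ x₀ hx₀ hx₀Ω
  have hf₀ : IsAdmissible hAB f := ⟨hf, hfd, hf', hcons, hΦ⟩
  have ht₀ : 0 ≤ t₀ := hx₀.1
  set z₀ := P₁ hAB x₀ with hz₀
  have hWpos : ∀ v ∈ Ω, 0 < 1 / 2 * inner ℝ (H v) v := fun v hv => by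
    have := hHpos v (ne_of_mem_of_not_mem hv hΩ₀)
    positivity
  set I : ℝ := ∫ v in Ioi (1 / 2 * inner ℝ (H z₀) z₀), 1 / U v with hI
  have hk_le : ∀ c, t₀ ≤ c → ∀ z : ℝ → X₁ A B, z t₀ = z₀ →
      IsIntegralCurveOn z hf₀.reducedField (Icc t₀ c) → (∀ t ∈ Icc t₀ c, z t ∈ Ω) →
      ∫ t in t₀..c, k t ≤ I := by
    intro c hc z hz0 hz hzΩ
    rw [hI, ← hz0]
    refine integral_le_integral_Ioi_of_mul_le_deriv (W := fun t => 1 / 2 * inner ℝ (H (z t)) (z t))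
      (W' := fun t => inner ℝ (H (z t)) (hf₀.reducedField t (z t))) hc
      (hk.mono fun t ht => ht₀.trans ht.1) hU hUpos (fun t ht => hWpos _ (hzΩ t ht))
      (hUint _ (hWpos _ (hzΩ t₀ ⟨le_rfl, hc⟩))) (fun t ht => ?_) fun t ht => ?_
    · have h₁ := ((H.hasFDerivAt.comp_hasDerivWithinAt t (hz t ht)).inner ℝ (hz t ht)).const_mul
        (1 / 2 : ℝ)
      refine h₁.congr_deriv ?_
      -- both terms of the derivative of `(H z, z)` agree because `H` is self-adjoint
      have h₂ : inner ℝ (H (hf₀.reducedField t (z t))) (z t) =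
          inner ℝ (H (z t)) (hf₀.reducedField t (z t)) := by
        rw [real_inner_comm]
        exact (hH.isSymmetric _ _).symm
      simp only [Function.comp_apply, h₂]
      ring
    · have hmem := hf₀.consistentPoint_mem_L₀ (ht₀.trans ht.1) (z t)
      have hP := hf₀.P₁_consistentPoint t (z t)
      have h₁ := hest t _ hmem (by rw [hP]; exact hzΩ t ht)
      rw [← hf₀.coe_reducedField_P₁ hmem, hP] at h₁
      exact h₁
  obtain ⟨M, hM⟩ := eventually_atTop.1 ((hkint t₀ ht₀).eventually_gt_atTop I)
  -- `Ω` is invariant only along solutions on half-open intervals, so that the estimate of the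
  -- integral of `k` is applied on `[t₀, c]` with `c = max t₀ M < b`.
  have hbound : ∀ b, t₀ ≤ b → ∀ z : ℝ → X₁ A B, z t₀ = z₀ →
      IsIntegralCurveOn z hf₀.reducedField (Icc t₀ b) → b ≤ max t₀ M := by
    intro b hb z hz0 hz
    by_contra! hlt
    have hzb : IsIntegralCurveOn z hf₀.reducedField (Ico t₀ b) := hz.mono Ico_subset_Icc_self
    have hsol := isSolution_of_isIntegralCurveOn hf₀ ((le_max_left _ _).trans_lt hlt) hx₀ hz0 hzb
    have hzΩ : ∀ t ∈ Ico t₀ b, z t ∈ Ω := fun t ht => by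
      have := hΩ t₀ x₀ hx₀ hx₀Ω _ _ hsol t (by rwa [interval_coe])
      rwa [hf₀.P₁_consistentPoint] at this
    have hsub : Icc t₀ (max t₀ M) ⊆ Ico t₀ b := fun t ht => ⟨ht.1, ht.2.trans_lt hlt⟩
    exact (hM _ (le_max_right _ _)).not_ge (hk_le _ (le_max_left _ _) z hz0 (hzb.mono hsub)
      fun t ht => hzΩ t (hsub ht))
  obtain ⟨T, hT, z, hz0, hz, hblow, hmax⟩ := exists_maximal_isIntegralCurveOn
    hf₀.locallyLipschitzUniformly_reducedField hf₀.continuous_reducedField t₀ z₀ _ hbound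
  refine ⟨T, fun t => hf₀.consistentPoint t (z t), hT,
    isSolution_of_isIntegralCurveOn hf₀ hT hx₀ hz0 hz, ?_, fun t₁ y hy => ?_⟩
  · -- `‖z‖ ≤ ‖P₁‖ ‖x‖`, where the norm of the projector may be zero
    have h₁ : ∀ t, ‖z t‖ / (‖P₁ hAB‖ + 1) ≤ ‖hf₀.consistentPoint t (z t)‖ := fun t => by
      rw [div_le_iff₀ (by positivity), mul_comm]
      calc ‖z t‖ = ‖P₁ hAB (hf₀.consistentPoint t (z t))‖ := by rw [hf₀.P₁_consistentPoint]
        _ ≤ ‖P₁ hAB‖ * ‖hf₀.consistentPoint t (z t)‖ := (P₁ hAB).le_opNorm _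
        _ ≤ _ := by gcongr; linarith
    exact tendsto_atTop_mono h₁ (hblow.atTop_div_const (by positivity))
  · have hycurve := hy.isIntegralCurveOn hf₀ ht₀
    have hsub : ∀ b : ℝ, (b : EReal) < t₁ → Icc t₀ b ⊆ interval t₀ t₁ := fun b hb t ht =>
      ⟨ht.1, (EReal.coe_le_coe_iff.2 ht.2).trans_lt hb⟩
    have hy₀ : P₁ hAB (y t₀) = z₀ := by rw [hy.initial]
    have key : ∀ b ∈ interval t₀ t₁, b < T ∧ EqOn (fun t => P₁ hAB (y t)) z (Icc t₀ b) :=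
      fun b hb => hmax b hb.1 _ hy₀ (hycurve.mono (hsub b hb.2))
    refine ⟨?_, fun t ht => ?_⟩
    · by_contra! hlt
      exact (key T ⟨hT.le, hlt⟩).1.false
    · have e : P₁ hAB (y t) = z t := (key t ht).2 ⟨ht.1, le_rfl⟩
      change y t = hf₀.consistentPoint t (z t)
      rw [← e, hf₀.consistentPoint_P₁ (hy.mem_L₀ hAB ht₀ ht)]
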